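/- Let $A$ be a locally $AW^*$-algebra, that is, a complex topological $^*$-algebra (not assumed unital) which is - a locally $C^*$-algebra: $A$ is topologically $^*$-isomorphic to the projective limit $\varprojlim A_\alpha$ (with the topology induced from the product $\prod_\alpha A_\alpha$) of a projective family of $C^*$-algebras $A_\alpha$ with connecting $^*$-homomorphisms $g_\alpha^\beta : A_\beta \to A_\alpha$, $\alpha \preceq \beta$, over a directed partially ordered set; and - a Baer $^*$-algebra: for every nonempty $S \subseteq A$ there is a projection $e = e^* = e^2 \in A$ such that the right annihilator $R(S) = \{x \in A : sx = 0 \text{ for all } s \in S\}$ equals $eA$. Let $N(A)$ be the set of continuous $C^*$-seminorms on $A$ (continuous submultiplicative seminorms $p$ with $p(a^*a) = p(a)^2$), put $\|a\|_\infty = \sup_{p \in N(A)} p(a)$, and let $b(A) = \{a \in A : \|a\|_\infty < \infty\}$ be the bounded part of $A$, a $^*$-subalgebra of $A$. Then $b(A)$ is an $AW^*$-algebra in the norm $\|\cdot\|_\infty$, i.e. it is a $C^*$-algebra in this norm and a Baer $^*$-algebra, and $b(A)$ is dense in $A$ in the topology of $A$. -/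

import Mathlib

universe u v w

section Baer

variable {A : Type u} [NonUnitalRing A]

/-- The right annihilator `R(S) = {x : s x = 0 for all s ∈ S}`. -/
def rightAnnihilator (S : Set A) : Set A := {x | ∀ s ∈ S, s * x = 0}

variable (A) in
/-- A Baer *-algebra: the right annihilator of every nonempty subset is `eA` for some
projection (self-adjoint idempotent) `e`. -/
def IsBaerStarAlgebra [StarRing A] : Prop :=
  ∀ S : Set A, S.Nonempty →
    ∃ e : A, IsStarProjection e ∧ rightAnnihilator S = {x | ∃ y : A, x = e * y}

end Baer

section ProjectiveLimit

/-- A projective family of C*-algebras over a partially ordered set, with connecting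
*-homomorphisms (automatically continuous) `B β → B α` for `α ≤ β`. -/
structure ProjectiveFamily (Λ : Type v) [PartialOrder Λ] (B : Λ → Type w)
    [∀ α, NonUnitalCStarAlgebra (B α)] where
  map : ∀ {α β : Λ}, α ≤ β → (B β →⋆ₙₐ[ℂ] B α)
  map_self : ∀ (α : Λ) (x : B α), map (le_refl α) x = x
  map_map : ∀ {α β γ : Λ} (h₁ : α ≤ β) (h₂ : β ≤ γ) (x : B γ),
    map h₁ (map h₂ x) = map (h₁.trans h₂) x

/-- The projective limit: the *-subalgebra of compatible families in the product `∏ B α`. As a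
subtype of the product it carries the topology induced by the product topology. -/
def ProjectiveFamily.limit {Λ : Type v} [PartialOrder Λ] {B : Λ → Type w}
    [∀ α, NonUnitalCStarAlgebra (B α)] (P : ProjectiveFamily Λ B) :
    NonUnitalStarSubalgebra ℂ (∀ α, B α) where
  carrier := {x | ∀ (α β : Λ) (h : α ≤ β), P.map h (x β) = x α}
  add_mem' := by
    intro x y hx hy α β h
    simp [hx α β h, hy α β h]
  zero_mem' := by
    intro α β h
    simp
  mul_mem' := by
    intro x y hx hy α β h
    simp [hx α β h, hy α β h]
  smul_mem' := by
    intro c x hx α β h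
    simp [hx α β h]
  star_mem' := by
    intro x hx α β h
    simp [map_star, hx α β h]

/-- A locally C*-algebra: a *-algebra with a topology that is topologically *-isomorphic to the
projective limit of a projective family of C*-algebras over a directed set. (The joint continuity
of the operations and the Hausdorff property follow from the isomorphism.) -/
def IsLocallyCStarAlgebra (A : Type u) [NonUnitalRing A] [Module ℂ A] [StarRing A]
    [TopologicalSpace A] : Prop :=
  ∃ (Λ : Type v) (_ : PartialOrder Λ) (_ : IsDirectedOrder Λ) (_ : Nonempty Λ)
    (B : Λ → Type w) (_ : ∀ α, NonUnitalCStarAlgebra (B α)) (P : ProjectiveFamily Λ B)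
    (φ : A ≃⋆ₐ[ℂ] P.limit), Continuous φ ∧ Continuous φ.symm

/-- A locally AW*-algebra: a locally C*-algebra which is a Baer *-algebra. -/
def IsLocallyAWStarAlgebra (A : Type u) [NonUnitalRing A] [Module ℂ A] [StarRing A]
    [TopologicalSpace A] : Prop :=
  IsLocallyCStarAlgebra.{u, v, w} A ∧ IsBaerStarAlgebra A

end ProjectiveLimit

section Bounded

variable (A : Type u) [NonUnitalRing A] [Module ℂ A] [StarRing A] [TopologicalSpace A]

/-- The set `N(A)` of continuous C*-seminorms on `A`. -/
def continuousCStarSeminorms : Set (Seminorm ℂ A) :=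
  {p | Continuous p ∧ (∀ a b, p (a * b) ≤ p a * p b) ∧ ∀ a, p (star a * a) = p a ^ 2}

variable {A} in
theorem continuousCStarSeminorms_star_le {p : Seminorm ℂ A}
    (hp : p ∈ continuousCStarSeminorms A) (a : A) : p (star a) ≤ p a := by
  have h1 := hp.2.2 (star a)
  have h2 := hp.2.1 (star (star a)) (star a)
  rw [h1, star_star] at h2
  rcases (apply_nonneg p (star a)).eq_or_lt with h | h
  · rw [← h]; exact apply_nonneg p a
  · nlinarith

/-- The bounded part `b(A)`: the elements on which the continuous C*-seminorms are uniformly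
bounded. It is a *-subalgebra of `A`. -/
def boundedPart [IsScalarTower ℂ A A] [SMulCommClass ℂ A A] [StarModule ℂ A] :
    NonUnitalStarSubalgebra ℂ A where
  carrier := {a | ∃ C : ℝ, ∀ p ∈ continuousCStarSeminorms A, p a ≤ C}
  add_mem' := by
    rintro a b ⟨C, hC⟩ ⟨D, hD⟩
    exact ⟨C + D, fun p hp => (map_add_le_add p a b).trans (add_le_add (hC p hp) (hD p hp))⟩
  zero_mem' := ⟨0, fun p _ => by simp⟩
  mul_mem' := by
    rintro a b ⟨C, hC⟩ ⟨D, hD⟩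
    exact ⟨C * D, fun p hp => (hp.2.1 a b).trans
      (mul_le_mul (hC p hp) (hD p hp) (apply_nonneg p b)
        ((apply_nonneg p a).trans (hC p hp)))⟩
  smul_mem' := by
    rintro c a ⟨C, hC⟩
    refine ⟨‖c‖ * C, fun p hp => ?_⟩
    rw [map_smul_eq_mul]
    exact mul_le_mul_of_nonneg_left (hC p hp) (norm_nonneg c)
  star_mem' := by
    rintro a ⟨C, hC⟩
    exact ⟨C, fun p hp => (continuousCStarSeminorms_star_le hp a).trans (hC p hp)⟩

variable {A} in
/-- `‖a‖_∞`, the supremum of `‖a‖_p` over all continuous C*-seminorms `p` of `A`, which for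
`a ∈ b(A)` is the supremum of a nonempty bounded set of reals. -/
noncomputable def supNorm (a : A) : ℝ :=
  ⨆ p : continuousCStarSeminorms A, (p : Seminorm ℂ A) a

end Bounded

section AWStar

variable (B : Type u) [NonUnitalRing B] [Module ℂ B] [StarRing B]

/-- The *-algebra `B` is a C*-algebra in the norm `N`: it is identified, as a *-algebra
with a norm, with a C*-algebra. -/
def IsCStarAlgebraInNorm (N : B → ℝ) : Prop :=
  ∃ (C : Type u) (_ : NonUnitalCStarAlgebra C) (φ : B ≃⋆ₐ[ℂ] C), ∀ b, ‖φ b‖ = N b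

/-- The *-algebra `B` is an AW*-algebra in the norm `N`: it is a C*-algebra in this norm and
a Baer *-algebra. -/
def IsAWStarAlgebraInNorm (N : B → ℝ) : Prop :=
  IsCStarAlgebraInNorm B N ∧ IsBaerStarAlgebra B

end AWStar

open Filter Topology
open scoped ENNReal

/-! Coordinate norms are continuous C*-seminorms, and conversely each continuous C*-seminorm is
dominated by a single coordinate norm (`exists_le_norm_coord`): directedness gives domination near
zero, and the C*-identity removes the constant. Hence `‖a‖_∞` is the supremum of the coordinate
norms, and `b(A)` is the closed *-subalgebra of compatible families in the bounded product `lp B ∞`,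
so a C*-algebra. The Baer property passes down because C*-seminorms are at most 1 on projections, so
the projections of `A` already lie in `b(A)`. Density comes from truncating self-adjoint elements by
functional calculus, coordinate by coordinate. -/

/-- A *-algebra with an injective *-homomorphism of closed range into a C*-algebra is a C*-algebra
in the norm pulled back along it. -/
theorem isCStarAlgebraInNorm_of_isClosed_range {C : Type u} [NonUnitalRing C] [Module ℂ C]
    [IsScalarTower ℂ C C] [SMulCommClass ℂ C C] [StarRing C] [StarModule ℂ C]
    {D : Type*} [NonUnitalCStarAlgebra D] (ψ : C →⋆ₙₐ[ℂ] D) (hinj : Function.Injective ψ)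
    (hcl : IsClosed (Set.range ψ)) : IsCStarAlgebraInNorm C (fun c => ‖ψ c‖) := by
  let i₁ : NonUnitalNormedRing C := NonUnitalNormedRing.induced C D ψ hinj
  let i₂ : NormedSpace ℂ C := NormedSpace.induced ℂ C D (ψ : C →ₗ[ℂ] D)
  have hiso : Isometry ψ := AddMonoidHomClass.isometry_of_norm ψ fun _ => rfl
  have hcomplete : CompleteSpace C := by
    rw [completeSpace_iff_isComplete_range hiso.isUniformInducing]
    exact hcl.isComplete
  have hstar : CStarRing C := ⟨fun x => by
    change ‖ψ x‖ * ‖ψ x‖ ≤ ‖ψ (star x * x)‖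
    rw [map_mul, map_star, CStarRing.norm_star_mul_self]⟩
  let i₃ : NonUnitalCStarAlgebra C := { i₁, i₂, ‹StarRing C›, hcomplete, hstar,
    ‹IsScalarTower ℂ C C›, ‹SMulCommClass ℂ C C›, ‹StarModule ℂ C› with }
  exact ⟨C, i₃, StarAlgEquiv.refl ℂ C, fun _ => rfl⟩

/-! ### C*-seminorms and projections -/

section CStarSeminorm

variable {A : Type u} [NonUnitalRing A] [Module ℂ A] [StarRing A]

/-- A C*-seminorm that is small wherever another one is small is dominated by it. -/
theorem Seminorm.le_of_star_mul_self_of_forall_lt {p q : Seminorm ℂ A}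
    (hp : ∀ a, p (star a * a) = p a ^ 2) (hq : ∀ a, q (star a * a) = q a ^ 2)
    {ε : ℝ} (hε : 0 < ε) (h : ∀ a, q a < ε → p a < 1) (a : A) : p a ≤ q a := by
  by_contra! hlt
  obtain ⟨r, hqr, hrp⟩ := exists_between hlt
  have hr : 0 < r := (apply_nonneg q a).trans_lt hqr
  have hnorm : ‖((r : ℂ)⁻¹)‖ = r⁻¹ := by
    rw [norm_inv, Complex.norm_real, Real.norm_of_nonneg hr.le]
  set b : A := (r : ℂ)⁻¹ • a
  have hpb : 1 ≤ p b := by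
    rw [map_smul_eq_mul, hnorm, inv_mul_eq_div, one_le_div hr]
    exact hrp.le
  have hqb : q b < 1 := by
    rw [map_smul_eq_mul, hnorm, inv_mul_eq_div, div_lt_one hr]
    exact hqr
  -- Now `q b < 1 ≤ p b`. Iterating `x ↦ star x * x` squares both values each time: `q` drops below
  -- `ε` while `p` stays at least 1.
  have iter (s : Seminorm ℂ A) (hs : ∀ a, s (star a * a) = s a ^ 2) (n : ℕ) :
      s ((fun x => star x * x)^[n] b) = s b ^ 2 ^ n := by
    induction n with
    | zero => simp
    | succ n ih => rw [Function.iterate_succ_apply', hs, ih, ← pow_mul, pow_succ]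
  have hlim : Tendsto (fun n : ℕ => q b ^ 2 ^ n) atTop (𝓝 0) :=
    (tendsto_pow_atTop_nhds_zero_of_lt_one (apply_nonneg q b) hqb).comp
      (tendsto_pow_atTop_atTop_of_one_lt one_lt_two)
  obtain ⟨n, hn⟩ := (hlim.eventually_lt_const hε).exists
  have := h _ ((iter q hq n).trans_lt hn)
  rw [iter p hp] at this
  exact (one_le_pow₀ hpb).not_gt this

variable [TopologicalSpace A]

theorem IsStarProjection.apply_le_one_of_mem_continuousCStarSeminorms {e : A}
    (he : IsStarProjection e) {p : Seminorm ℂ A} (hp : p ∈ continuousCStarSeminorms A) :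
    p e ≤ 1 := by
  have h := hp.2.2 e
  rw [he.isSelfAdjoint.star_eq, he.isIdempotentElem.eq] at h
  nlinarith

/-- The bounded part of a topological Baer *-algebra is a Baer *-algebra. -/
theorem IsBaerStarAlgebra.boundedPart [IsScalarTower ℂ A A] [SMulCommClass ℂ A A]
    [StarModule ℂ A] (hA : IsBaerStarAlgebra A) : IsBaerStarAlgebra (boundedPart A) := by
  intro S hS
  obtain ⟨e, he, hSe⟩ := hA (Subtype.val '' S) (hS.image _)
  have hmem (x : A) : (∀ s ∈ S, (s : A) * x = 0) ↔ ∃ y, x = e * y := by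
    have := Set.ext_iff.1 hSe x
    simpa [rightAnnihilator] using this
  refine ⟨⟨e, 1, fun p hp => he.apply_le_one_of_mem_continuousCStarSeminorms hp⟩,
    ⟨Subtype.ext he.isIdempotentElem, Subtype.ext he.isSelfAdjoint⟩, Set.ext fun x => ?_⟩
  have hx : x ∈ rightAnnihilator S ↔ ∃ y, (x : A) = e * y := by
    rw [← hmem]
    simp [rightAnnihilator, Subtype.ext_iff]
  rw [hx]
  constructor
  · rintro ⟨y, hy⟩
    -- The factor `y` may be unbounded, but `x = e * y` gives `e * x = x`, so `x` itself serves.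
    refine ⟨x, Subtype.ext ?_⟩
    change (x : A) = e * x
    rw [hy, ← mul_assoc, he.isIdempotentElem.eq]
  · rintro ⟨y, hy⟩
    exact ⟨y, congrArg Subtype.val hy⟩

end CStarSeminorm

/-! ### Coordinates of the projective limit -/

namespace ProjectiveFamily

variable {Λ : Type v} [PartialOrder Λ] {B : Λ → Type w} [∀ α, NonUnitalCStarAlgebra (B α)]
  {P : ProjectiveFamily Λ B} {A : Type u} [NonUnitalRing A] [Module ℂ A] [StarRing A]

theorem continuous_map (P : ProjectiveFamily Λ B) {α β : Λ} (h : α ≤ β) :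
    Continuous (P.map h) :=
  AddMonoidHomClass.continuous_of_bound (P.map h) 1 fun x => by
    simpa using NonUnitalStarAlgHom.norm_apply_le (P.map h) x

/-- The coordinate *-homomorphisms of a *-algebra identified with a projective limit. -/
def coord (φ : A ≃⋆ₐ[ℂ] P.limit) (α : Λ) : A →⋆ₙₐ[ℂ] B α where
  toFun a := (φ a : ∀ α, B α) α
  map_smul' c a := by simp
  map_zero' := by simp
  map_add' a b := by simp
  map_mul' a b := by simp
  map_star' a := by simp [map_star]

variable (φ : A ≃⋆ₐ[ℂ] P.limit)

theorem map_coord {α β : Λ} (h : α ≤ β) (a : A) : P.map h (coord φ β a) = coord φ α a :=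
  (φ a).2 α β h

theorem exists_coord_eq (f : ∀ α, B α) (hf : ∀ (α β : Λ) (h : α ≤ β), P.map h (f β) = f α) :
    ∃ a, ∀ α, coord φ α a = f α :=
  ⟨φ.symm ⟨f, hf⟩, fun α => by simp [coord]⟩

theorem ext_coord {a b : A} (h : ∀ α, coord φ α a = coord φ α b) : a = b :=
  φ.injective (Subtype.ext (funext h))

/-- The C*-seminorm given by the norm of a coordinate. -/
noncomputable def coordSeminorm (α : Λ) : Seminorm ℂ A :=
  (normSeminorm ℂ (B α)).comp (coord φ α : A →ₗ[ℂ] B α)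

theorem coordSeminorm_apply (α : Λ) (a : A) : coordSeminorm φ α a = ‖coord φ α a‖ := rfl

theorem coordSeminorm_star_mul_self (α : Λ) (a : A) :
    coordSeminorm φ α (star a * a) = coordSeminorm φ α a ^ 2 := by
  simp only [coordSeminorm_apply, map_mul, map_star, CStarRing.norm_star_mul_self, sq]

variable [TopologicalSpace A]

theorem continuous_coord {φ : A ≃⋆ₐ[ℂ] P.limit} (hφ : Continuous φ) (α : Λ) :
    Continuous (coord φ α) :=
  (continuous_apply α).comp (continuous_subtype_val.comp hφ)

theorem isInducing_coord {φ : A ≃⋆ₐ[ℂ] P.limit} (hφ : Continuous φ) (hφ' : Continuous φ.symm) :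
    IsInducing fun a α => coord φ α a :=
  IsInducing.subtypeVal.comp
    (Homeomorph.mk φ.toEquiv hφ hφ').isInducing

theorem coordSeminorm_mem {φ : A ≃⋆ₐ[ℂ] P.limit} (hφ : Continuous φ) (α : Λ) :
    coordSeminorm φ α ∈ continuousCStarSeminorms A := by
  refine ⟨(continuous_coord hφ α).norm, fun a b => ?_, coordSeminorm_star_mul_self φ α⟩
  simp only [coordSeminorm_apply, map_mul]
  exact norm_mul_le _ _

/-- Every neighbourhood of zero contains a ball of some coordinate seminorm. -/
theorem exists_forall_norm_coord_lt [IsDirectedOrder Λ] [Nonempty Λ] {φ : A ≃⋆ₐ[ℂ] P.limit}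
    (hφ : Continuous φ) (hφ' : Continuous φ.symm) {U : Set A} (hU : U ∈ 𝓝 (0 : A)) :
    ∃ α, ∃ ε > 0, ∀ a, ‖coord φ α a‖ < ε → a ∈ U := by
  -- Directedness lets one coordinate, rather than a finite set of them, control a neighbourhood.
  have hdir : Directed (· ≥ ·) fun α => comap (coord φ α) (𝓝 0) := by
    intro α β
    obtain ⟨γ, hα, hβ⟩ := exists_ge_ge α β
    have key {δ : Λ} (h : δ ≤ γ) : comap (coord φ γ) (𝓝 0) ≤ comap (coord φ δ) (𝓝 0) := by
      have hcomp : ⇑(coord φ δ) = P.map h ∘ coord φ γ := funext fun a => (map_coord φ h a).symm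
      rw [hcomp, ← comap_comap]
      refine comap_mono (tendsto_iff_comap.1 ?_)
      simpa using (P.continuous_map h).tendsto 0
    exact ⟨γ, key hα, key hβ⟩
  have hnhds : 𝓝 (0 : A) = ⨅ α, comap (coord φ α) (𝓝 0) := by
    rw [(isInducing_coord hφ hφ').nhds_eq_comap, nhds_pi, Filter.pi, comap_iInf]
    simp only [comap_comap, map_zero]
    rfl
  rw [hnhds, mem_iInf_of_directed hdir] at hU
  obtain ⟨α, hα⟩ := hU
  obtain ⟨ε, hε, h⟩ := (Metric.nhds_basis_ball.comap (coord φ α)).mem_iff.1 hα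
  exact ⟨α, ε, hε, fun a ha => h (by simpa using ha)⟩

/-- Every continuous C*-seminorm is dominated by a coordinate seminorm. -/
theorem exists_le_norm_coord [IsDirectedOrder Λ] [Nonempty Λ] {φ : A ≃⋆ₐ[ℂ] P.limit}
    (hφ : Continuous φ) (hφ' : Continuous φ.symm) {p : Seminorm ℂ A}
    (hp : p ∈ continuousCStarSeminorms A) : ∃ α, ∀ a, p a ≤ ‖coord φ α a‖ := by
  have hU : {a | p a < 1} ∈ 𝓝 (0 : A) :=
    (isOpen_lt hp.1 continuous_const).mem_nhds (by simp)
  obtain ⟨α, ε, hε, h⟩ := exists_forall_norm_coord_lt hφ hφ' hU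
  exact ⟨α, Seminorm.le_of_star_mul_self_of_forall_lt hp.2.2
    (coordSeminorm_star_mul_self φ α) hε h⟩

/-! ### The bounded part as a C*-algebra -/

variable [IsScalarTower ℂ A A] [SMulCommClass ℂ A A] [StarModule ℂ A]

theorem mem_boundedPart_iff [IsDirectedOrder Λ] [Nonempty Λ] {φ : A ≃⋆ₐ[ℂ] P.limit}
    (hφ : Continuous φ) (hφ' : Continuous φ.symm) {a : A} :
    a ∈ boundedPart A ↔ ∃ C : ℝ, ∀ α, ‖coord φ α a‖ ≤ C := by
  constructor
  · rintro ⟨C, hC⟩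
    exact ⟨C, fun α => hC _ (coordSeminorm_mem hφ α)⟩
  · rintro ⟨C, hC⟩
    refine ⟨C, fun p hp => ?_⟩
    obtain ⟨α, hα⟩ := exists_le_norm_coord hφ hφ' hp
    exact (hα a).trans (hC α)

/-- The bounded part, embedded into the C*-algebra of bounded families. -/
noncomputable def boundedPartToLp {φ : A ≃⋆ₐ[ℂ] P.limit} (hφ : Continuous φ) :
    boundedPart A →⋆ₙₐ[ℂ] lp B ∞ where
  toFun a := ⟨fun α => coord φ α a, memℓp_infty (by
    obtain ⟨C, hC⟩ := a.2
    exact ⟨C, Set.forall_mem_range.2 fun α => hC _ (coordSeminorm_mem hφ α)⟩)⟩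
  map_smul' c a := by ext α; exact map_smul (coord φ α) c (a : A)
  map_zero' := by ext α; exact map_zero (coord φ α)
  map_add' a b := by ext α; exact map_add (coord φ α) (a : A) b
  map_mul' a b := by ext α; exact map_mul (coord φ α) (a : A) b
  map_star' a := by ext α; exact map_star (coord φ α) (a : A)

theorem boundedPartToLp_apply {φ : A ≃⋆ₐ[ℂ] P.limit} (hφ : Continuous φ) (a : boundedPart A)
    (α : Λ) : boundedPartToLp hφ a α = coord φ α a := rfl

theorem boundedPartToLp_injective {φ : A ≃⋆ₐ[ℂ] P.limit} (hφ : Continuous φ) :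
    Function.Injective (boundedPartToLp hφ) := fun a b h =>
  Subtype.ext (ext_coord φ fun α => by
    rw [← boundedPartToLp_apply hφ, ← boundedPartToLp_apply hφ, h])

theorem norm_boundedPartToLp [IsDirectedOrder Λ] [Nonempty Λ] {φ : A ≃⋆ₐ[ℂ] P.limit}
    (hφ : Continuous φ) (hφ' : Continuous φ.symm) (a : boundedPart A) :
    ‖boundedPartToLp hφ a‖ = supNorm (a : A) := by
  obtain ⟨C, hC⟩ := a.2
  have : Nonempty (continuousCStarSeminorms A) :=
    ⟨⟨_, coordSeminorm_mem hφ (Classical.arbitrary Λ)⟩⟩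
  have hbdd : BddAbove (Set.range fun p : continuousCStarSeminorms A =>
      (p : Seminorm ℂ A) (a : A)) :=
    ⟨C, Set.forall_mem_range.2 fun p => hC p p.2⟩
  apply le_antisymm
  · exact (lp.isLUB_norm _).2 <| Set.forall_mem_range.2 fun α =>
      le_ciSup hbdd ⟨_, coordSeminorm_mem hφ α⟩
  · refine ciSup_le fun p => ?_
    obtain ⟨α, hα⟩ := exists_le_norm_coord hφ hφ' p.2
    exact (hα a).trans (lp.norm_apply_le_norm ENNReal.top_ne_zero (boundedPartToLp hφ a) α)

/-- Compatibility is a closed condition on bounded families, since evaluations and connecting maps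
are continuous. -/
theorem isClosed_range_boundedPartToLp [IsDirectedOrder Λ] [Nonempty Λ]
    {φ : A ≃⋆ₐ[ℂ] P.limit} (hφ : Continuous φ) (hφ' : Continuous φ.symm) :
    IsClosed (Set.range (boundedPartToLp hφ)) := by
  have hrange : Set.range (boundedPartToLp hφ) =
      ⋂ (α : Λ) (β : Λ) (h : α ≤ β), {f : lp B ∞ | P.map h (f β) = f α} := by
    ext f
    simp only [Set.mem_range, Set.mem_iInter, Set.mem_ofPred_eq]
    constructor
    · rintro ⟨a, rfl⟩ α β h
      exact map_coord φ h a
    · intro hf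
      obtain ⟨a, ha⟩ := exists_coord_eq φ f hf
      refine ⟨⟨a, (mem_boundedPart_iff hφ hφ').2 ⟨‖f‖, fun α => ?_⟩⟩, lp.ext (funext ha)⟩
      rw [ha]
      exact lp.norm_apply_le_norm ENNReal.top_ne_zero f α
  have heval (α : Λ) : Continuous fun f : lp B ∞ => f α := (lp.evalCLM ℂ B ∞ α).continuous
  rw [hrange]
  exact isClosed_iInter fun α => isClosed_iInter fun β => isClosed_iInter fun h =>
    isClosed_eq ((P.continuous_map h).comp (heval β)) (heval α)

/-- A self-adjoint element is the limit of its truncations, which are bounded. -/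
theorem mem_closure_boundedPart_of_isSelfAdjoint [IsDirectedOrder Λ] [Nonempty Λ]
    {φ : A ≃⋆ₐ[ℂ] P.limit} (hφ : Continuous φ) (hφ' : Continuous φ.symm) {a : A}
    (ha : IsSelfAdjoint a) : a ∈ closure (boundedPart A : Set A) := by
  let f (n : ℕ) (t : ℝ) : ℝ := max (-n) (min n t)
  have hf (n : ℕ) : Continuous (f n) := by fun_prop
  have hf₀ (n : ℕ) : f n 0 = 0 := by simp [f]
  have hsa (α : Λ) : IsSelfAdjoint (coord φ α a) := ha.map (coord φ α)
  have hex (n : ℕ) : ∃ b, ∀ α, coord φ α b = cfcₙ (f n) (coord φ α a) := by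
    -- Functional calculus commutes with the connecting *-homomorphisms, so the truncated
    -- coordinates are compatible.
    refine exists_coord_eq φ _ fun α β h => ?_
    rw [NonUnitalStarAlgHom.map_cfcₙ (P.map h) (f n) _ (hf n).continuousOn (hf₀ n)
      (P.continuous_map h) (hsa β) ((hsa β).map _), map_coord]
  choose b hb using hex
  have hbdd (n : ℕ) : b n ∈ boundedPart A := by
    refine (mem_boundedPart_iff hφ hφ').2 ⟨n, fun α => ?_⟩
    rw [hb]
    refine norm_cfcₙ_le fun t _ => abs_le.2 ⟨le_max_left _ _, max_le ?_ (min_le_left _ _)⟩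
    linarith [n.cast_nonneg (α := ℝ)]
  refine mem_closure_of_tendsto (b := atTop) (f := b) ?_ (Eventually.of_forall hbdd)
  rw [(isInducing_coord hφ hφ').tendsto_nhds_iff, tendsto_pi_nhds]
  intro α
  -- For `n ≥ ‖coord φ α a‖`, `f n` is the identity on the quasispectrum, so this coordinate of `b
  -- n` is eventually constant.
  obtain ⟨N, hN⟩ := exists_nat_ge ‖coord φ α a‖
  refine tendsto_const_nhds.congr' ?_
  filter_upwards [eventually_ge_atTop N] with n hn
  change coord φ α a = coord φ α (b n)
  rw [hb]
  conv_lhs => rw [← cfcₙ_id' ℝ (coord φ α a) (hsa α)]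
  refine cfcₙ_congr fun t ht => ?_
  have ht' : |t| ≤ n := by
    have := norm_apply_le_norm_cfcₙ (fun x : ℝ => x) (coord φ α a) ht continuousOn_id rfl (hsa α)
    rw [cfcₙ_id' ℝ (coord φ α a) (hsa α), Real.norm_eq_abs] at this
    exact this.trans (hN.trans (by exact_mod_cast hn))
  rw [abs_le] at ht'
  simp [f, ht'.1, ht'.2]

theorem dense_boundedPart [IsDirectedOrder Λ] [Nonempty Λ] {φ : A ≃⋆ₐ[ℂ] P.limit}
    (hφ : Continuous φ) (hφ' : Continuous φ.symm) : Dense (boundedPart A : Set A) := by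
  -- Continuity of the operations on `A` is inherited from the coordinates.
  have hadd : Continuous fun x : A × A => x.1 + x.2 := by
    refine (isInducing_coord hφ hφ').continuous_iff.2 (continuous_pi fun α => ?_)
    simp only [Function.comp_def, map_add]
    exact ((continuous_coord hφ α).comp continuous_fst).add
      ((continuous_coord hφ α).comp continuous_snd)
  have hsmul : Continuous fun x : A => Complex.I • x := by
    refine (isInducing_coord hφ hφ').continuous_iff.2 (continuous_pi fun α => ?_)
    simp only [Function.comp_def, map_smul]
    exact (continuous_coord hφ α).const_smul _
  intro a
  rw [← realPart_add_I_smul_imaginaryPart a]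
  refine map_mem_closure₂ hadd
    (mem_closure_boundedPart_of_isSelfAdjoint hφ hφ' (realPart a).2)
    (map_mem_closure hsmul
      (mem_closure_boundedPart_of_isSelfAdjoint hφ hφ' (imaginaryPart a).2)
      fun x hx => SMulMemClass.smul_mem Complex.I hx)
    fun x hx y hy => (boundedPart A).add_mem hx hy

end ProjectiveFamily

theorem theorem3 (A : Type u) [NonUnitalRing A] [Module ℂ A] [IsScalarTower ℂ A A]
    [SMulCommClass ℂ A A] [StarRing A] [StarModule ℂ A] [TopologicalSpace A]
    (hA : IsLocallyAWStarAlgebra.{u, v, w} A) :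
    IsAWStarAlgebraInNorm (boundedPart A) (fun a => supNorm (a : A)) ∧
      Dense (boundedPart A : Set A) := by
  obtain ⟨⟨Λ, _, _, _, B, _, P, φ, hφ, hφ'⟩, hBaer⟩ := hA
  refine ⟨⟨?_, hBaer.boundedPart⟩, ProjectiveFamily.dense_boundedPart hφ hφ'⟩
  simp only [← ProjectiveFamily.norm_boundedPartToLp hφ hφ']
  exact isCStarAlgebraInNorm_of_isClosed_range _
    (ProjectiveFamily.boundedPartToLp_injective hφ)
    (ProjectiveFamily.isClosed_range_boundedPartToLp hφ hφ')
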